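/- Let $X=(X_t)_{t\ge 0}$ be a real-valued Lévy process ($X_0=0$ a.s., stationary independent increments, a.s. càdlàg paths) with $E|X_1|<\infty$ and $m_X=E X_1>0$, and let $f:[0,\infty)\to\mathbb R$ be a deterministic càdlàg function. Let $$V_t=X_t-\min\Bigl(0,\inf_{0\le s\le t}(X_s-f(s))\Bigr)$$ be $X$ reflected at $f$, let $\tau(u)=\inf\{t\ge 0: V_t>u\}$ for $u\in\mathbb R$, and let $f^{-1}(u)=\inf\{t\ge 0: f(t)\ge u\}$ (with $\inf\emptyset=\infty$). Then $\tau(u)<\infty$ a.s. for every $u$, and the following hold as $u\to\infty$. (i) If $X_t-f(t)\to+\infty$ a.s. as $t\to\infty$, then $\tau(u)/u\to 1/m_X$ in probability. If moreover $\omega_X^2=\operatorname{Var}(X_1)<\infty$, then $$\frac{\tau(u)-u/m_X}{\sqrt u}\Rightarrow N\!\left(0,\frac{\omega_X^2}{m_X^3}\right)$$ in distribution, where $N(0,0)$ is the point mass at $0$. (ii) If $X_t-f(t)\to-\infty$ a.s. as $t\to\infty$ and the limit $\ell=\lim_{u\to\infty}f^{-1}(u)/u$ exists in $[0,\infty]$,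 then $\ell<\infty$ and $\tau(u)/u\to\ell$ in probability. -/

import Mathlib

open MeasureTheory ProbabilityTheory Filter Topology
open scoped NNReal ENNReal

noncomputable section

/-- A function of time is càdlàg: right continuous with (finite) left limits. -/
def IsCadlag (f : ℝ≥0 → ℝ) : Prop :=
  ∀ t : ℝ≥0, ContinuousWithinAt f (Set.Ici t) t ∧ ∃ l : ℝ, Tendsto f (𝓝[<] t) (𝓝 l)

/-- A real-valued Lévy process: it starts at zero, has independent and stationary increments, and
its paths are almost surely càdlàg. -/
structure IsLevyProcess {Ω : Type*} [MeasurableSpace Ω] (X : ℝ≥0 → Ω → ℝ) (P : Measure Ω) :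
    Prop where
  measurable : ∀ t, Measurable (X t)
  zero : ∀ᵐ ω ∂P, X 0 ω = 0
  indep : HasIndepIncrements X P
  stationary : ∀ s t, IdentDistrib (fun ω => X (s + t) ω - X s ω) (X t) P P
  cadlag : ∀ᵐ ω ∂P, IsCadlag (fun t => X t ω)

/-- The path `x` reflected at the barrier `f`:
`V_t = x_t - min (0, inf_{0 ≤ s ≤ t} (x_s - f s))`.
For càdlàg `x` and `f` the infimum is over a nonempty set that is bounded below. -/
def reflect (f x : ℝ≥0 → ℝ) (t : ℝ≥0) : ℝ :=
  x t - min 0 (⨅ s : Set.Iic t, (x s - f s))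

/-- The first passage time of the path `v` strictly above the level `u`, `inf {t ≥ 0 : v t > u}`,
equal to `∞` when the level is never exceeded. -/
def passageTime (v : ℝ≥0 → ℝ) (u : ℝ) : ℝ≥0∞ :=
  ⨅ (t : ℝ≥0) (_ : u < v t), (t : ℝ≥0∞)

/-- The generalized inverse `f⁻¹(u) = inf {t ≥ 0 : f t ≥ u}`, with `inf ∅ = ∞`. -/
def barrierInv (f : ℝ≥0 → ℝ) (u : ℝ) : ℝ≥0∞ :=
  ⨅ (t : ℝ≥0) (_ : u ≤ f t), (t : ℝ≥0∞)

/-- The first passage time `τ(u)` of the process `X` reflected at the barrier `f`. -/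
def tau {Ω : Type*} (f : ℝ≥0 → ℝ) (X : ℝ≥0 → Ω → ℝ) (u : ℝ) (ω : Ω) : ℝ≥0∞ :=
  passageTime (reflect f (fun t => X t ω)) u

end

/-! The reflected path exceeds `u` at `t` exactly when `x t > u` or `x t + (f s - x s) > u` for some
`s ≤ t` (`lt_reflect_iff`). Everything else compares the drift of `X` with this criterion.
Finiteness of `τ(u)` is immediate from `X n / n → m > 0`.

If `X - f → +∞`, then `f - X` has an almost surely finite supremum, hence is at most some `K` off an
event of small probability. There `V` lies between `X` and `X + K`, so when `X t - m t` stays within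
`e` of a constant `c` near `τ`, one gets `|m τ + c - u| ≤ e + K` (`abs_toReal_passageTime_sub_le`).
With `c = 0` and a weak law uniform on `[0, 2u/m]`, this gives `τ/u → 1/m`. With `c = X n - m n`, `n
= ⌊u/m⌋`, and fluctuations of order at most a small multiple of `√u` on a window of width `ε₁ u`,
the variable `(τ - u/m)/√u` is close to `-(X n - m n)/(m √u)`, to which the classical central limit
theorem applies. Both uniform estimates come from Ottaviani's inequality, carried to continuous time
by right continuity.

If `X - f → -∞`, the barrier eventually beats every slope below `m`, so `ℓ m ≤ 1`. Since `V ≥ f`,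
`τ(u) ≤ f⁻¹(u + 1)`. Conversely, for `0 < ρ < ℓ` the barrier lies below a line of slope `1/ρ ≥ m`.
Following the barrier to `s` and the drift from `s` to `t` reaches at most about `t/ρ`, so `τ(u)`
cannot be much below `ρ u`. -/

/-! ### Càdlàg functions -/

lemma IsCadlag.neg {f : ℝ≥0 → ℝ} (hf : IsCadlag f) : IsCadlag (fun t => - f t) := fun t =>
  ⟨(hf t).1.neg, let ⟨l, hl⟩ := (hf t).2; ⟨-l, hl.neg⟩⟩

lemma IsCadlag.add {f g : ℝ≥0 → ℝ} (hf : IsCadlag f) (hg : IsCadlag g) :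
    IsCadlag (fun t => f t + g t) := fun t =>
  ⟨(hf t).1.add (hg t).1,
    let ⟨l, hl⟩ := (hf t).2; let ⟨k, hk⟩ := (hg t).2; ⟨l + k, hl.add hk⟩⟩

lemma IsCadlag.sub {f g : ℝ≥0 → ℝ} (hf : IsCadlag f) (hg : IsCadlag g) :
    IsCadlag (fun t => f t - g t) := by
  simpa [sub_eq_add_neg] using hf.add hg.neg

lemma Continuous.isCadlag {f : ℝ≥0 → ℝ} (hf : Continuous f) : IsCadlag f := fun t =>
  ⟨hf.continuousWithinAt, f t, hf.continuousAt.tendsto.mono_left nhdsWithin_le_nhds⟩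

lemma IsCadlag.const_mul {f : ℝ≥0 → ℝ} (hf : IsCadlag f) (c : ℝ) :
    IsCadlag (fun t => c * f t) := fun t =>
  ⟨(hf t).1.const_smul c, let ⟨l, hl⟩ := (hf t).2; ⟨c * l, hl.const_mul c⟩⟩

/-- A càdlàg function is bounded on compact time intervals. -/
lemma IsCadlag.exists_abs_le {f : ℝ≥0 → ℝ} (hf : IsCadlag f) (T : ℝ≥0) :
    ∃ K : ℝ, ∀ t ≤ T, |f t| ≤ K := by
  have key : ∃ K : ℝ, ∀ t ∈ Set.Icc 0 T, |f t| ≤ K := by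
    refine (isCompact_Icc (a := (0 : ℝ≥0)) (b := T)).induction_on
      (p := fun s => ∃ K : ℝ, ∀ t ∈ s, |f t| ≤ K) ⟨0, by simp⟩ ?_ ?_ ?_
    · rintro s t hst ⟨K, hK⟩
      exact ⟨K, fun r hr => hK r (hst hr)⟩
    · rintro s t ⟨K, hK⟩ ⟨L, hL⟩
      refine ⟨max K L, ?_⟩
      rintro r (hr | hr)
      · exact (hK r hr).trans (le_max_left _ _)
      · exact (hL r hr).trans (le_max_right _ _)
    · intro t _
      obtain ⟨hr, l, hl⟩ := hf t
      have h1 : ∀ᶠ s in 𝓝[≥] t, |f s| < |f t| + 1 :=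
        hr.tendsto.abs.eventually_lt_const (lt_add_one _)
      have h2 : ∀ᶠ s in 𝓝[<] t, |f s| < |l| + 1 := hl.abs.eventually_lt_const (lt_add_one _)
      have h3 : ∀ᶠ s in 𝓝 t, |f s| ≤ max (|f t| + 1) (|l| + 1) := by
        rw [← nhdsLT_sup_nhdsGE, eventually_sup]
        exact ⟨h2.mono fun s hs => hs.le.trans (le_max_right _ _),
          h1.mono fun s hs => hs.le.trans (le_max_left _ _)⟩
      exact ⟨_, mem_nhdsWithin_of_mem_nhds h3, _, fun s hs => hs⟩
  obtain ⟨K, hK⟩ := key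
  exact ⟨K, fun t ht => hK t ⟨zero_le, ht⟩⟩

/-- A strict inequality for a càdlàg function persists at times of a dense sequence just to the
right. -/
lemma IsCadlag.exists_denseSeq_gt {f : ℝ≥0 → ℝ} (hf : IsCadlag f) {c : ℝ} {t : ℝ≥0}
    (ht : c < f t) {S : Set ℝ≥0} (hS : S ∈ 𝓝 t) :
    ∃ n, t < TopologicalSpace.denseSeq ℝ≥0 n ∧ TopologicalSpace.denseSeq ℝ≥0 n ∈ S ∧
      c < f (TopologicalSpace.denseSeq ℝ≥0 n) := by
  have h1 : ∀ᶠ s in 𝓝[>] t, c < f s :=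
    ((hf t).1.tendsto.mono_left (nhdsWithin_mono t Set.Ioi_subset_Ici_self)).eventually_const_lt ht
  have h2 : ∀ᶠ s in 𝓝[>] t, s ∈ S := mem_nhdsWithin_of_mem_nhds hS
  obtain ⟨r, hr, hr'⟩ := (mem_nhdsGT_iff_exists_Ioo_subset).1 (h1.and h2)
  obtain ⟨_, ⟨n, rfl⟩, hn⟩ := (TopologicalSpace.denseRange_denseSeq ℝ≥0).exists_between hr
  exact ⟨n, hn.1, (hr' hn).2, (hr' hn).1⟩

/-! ### The reflected path and its first passage times -/

/-- Local boundedness of càdlàg paths makes the infimum genuine, so a strict bound on it is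
witnessed by some `s`, attained or not. -/
lemma lt_reflect_iff {f x : ℝ≥0 → ℝ} (hf : IsCadlag f) (hx : IsCadlag x) {u : ℝ} {t : ℝ≥0} :
    u < reflect f x t ↔ u < x t ∨ ∃ s ≤ t, u < x t - x s + f s := by
  have hbdd : BddBelow (Set.range fun s : Set.Iic t => x s - f s) := by
    obtain ⟨K, hK⟩ := (hx.sub hf).exists_abs_le t
    exact ⟨-K, by rintro _ ⟨s, rfl⟩; exact neg_le_of_abs_le (hK s s.2)⟩
  have : Nonempty (Set.Iic t) := ⟨⟨t, Set.mem_Iic.2 le_rfl⟩⟩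
  rw [reflect, lt_sub_comm, min_lt_iff, ciInf_lt_iff hbdd]
  refine or_congr (by simp) ⟨?_, ?_⟩
  · rintro ⟨s, hs⟩
    exact ⟨s, s.2, by linarith⟩
  · rintro ⟨s, hst, hs⟩
    exact ⟨⟨s, hst⟩, by simp only; linarith⟩

lemma passageTime_le {v : ℝ≥0 → ℝ} {u : ℝ} {t : ℝ≥0} (h : u < v t) : passageTime v u ≤ t :=
  iInf₂_le t h

lemma le_of_lt_passageTime {v : ℝ≥0 → ℝ} {u : ℝ} {t : ℝ≥0} (h : (t : ℝ≥0∞) < passageTime v u) :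
    v t ≤ u :=
  le_of_not_gt fun h' => (passageTime_le h').not_gt h

lemma exists_of_passageTime_lt {v : ℝ≥0 → ℝ} {u : ℝ} {T : ℝ≥0∞} (h : passageTime v u < T) :
    ∃ t : ℝ≥0, t < T ∧ u < v t := by
  simp only [passageTime, iInf_lt_iff] at h
  obtain ⟨t, h1, h2⟩ := h
  exact ⟨t, h2, h1⟩

lemma le_of_lt_toReal_passageTime {v : ℝ≥0 → ℝ} {u : ℝ} (hfin : passageTime v u < ∞) {t : ℝ≥0}
    (h : (t : ℝ) < (passageTime v u).toReal) : v t ≤ u := by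
  refine le_of_lt_passageTime ?_
  rw [← ENNReal.toReal_lt_toReal ENNReal.coe_ne_top hfin.ne]
  simpa using h

lemma exists_of_toReal_passageTime_lt {v : ℝ≥0 → ℝ} {u : ℝ} (hfin : passageTime v u < ∞) {T : ℝ}
    (h : (passageTime v u).toReal < T) :
    ∃ t : ℝ≥0, (passageTime v u).toReal ≤ t ∧ (t : ℝ) < T ∧ u < v t := by
  have h' : passageTime v u < ENNReal.ofReal T := by
    rwa [ENNReal.lt_ofReal_iff_toReal_lt hfin.ne]
  obtain ⟨t, ht, hu⟩ := exists_of_passageTime_lt h'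
  refine ⟨t, ?_, ?_, hu⟩
  · exact ENNReal.toReal_le_coe_of_le_coe (passageTime_le hu)
  · rw [ENNReal.lt_ofReal_iff_toReal_lt ENNReal.coe_ne_top] at ht
    simpa using ht

/-! ### Maximal inequalities, from partial sums to Lévy processes -/

/-- Ottaviani's maximal inequality for partial sums of independent random variables. -/
lemma ProbabilityTheory.iIndepFun.measure_exists_sum_gt_le {Ω : Type*} [MeasurableSpace Ω]
    {P : Measure Ω} [IsProbabilityMeasure P] {ξ : ℕ → Ω → ℝ} (hξ : ∀ i, Measurable (ξ i))
    (hindep : iIndepFun ξ P) {a b : ℝ} {η : ℝ≥0∞} {N : ℕ}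
    (h : ∀ k ≤ N, P {ω | ∑ i ∈ Finset.range N, ξ i ω - ∑ i ∈ Finset.range k, ξ i ω < -b} ≤ η) :
    P {ω | ∃ k ≤ N, a + b < ∑ i ∈ Finset.range k, ξ i ω} ≤
      P {ω | a < ∑ i ∈ Finset.range N, ξ i ω} + η := by
  set S : ℕ → Ω → ℝ := fun k ω => ∑ i ∈ Finset.range k, ξ i ω with hS
  have hSm : ∀ k, Measurable (S k) := fun k => Finset.measurable_fun_sum _ fun i _ => hξ i
  -- `E k`: the level `a + b` is first exceeded at `k`; `B k`: the sum then falls by more than `b`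
  -- up to `N`. They depend on disjoint blocks of variables, and `E k` without `B k` forces `S N >
  -- a`.
  let E : ℕ → Set Ω := fun k => {ω | a + b < S k ω ∧ ∀ j < k, S j ω ≤ a + b}
  let B : ℕ → Set Ω := fun k => {ω | S N ω - S k ω < -b}
  have hEm : ∀ k, MeasurableSet (E k) := fun k => by measurability
  have hBm : ∀ k, MeasurableSet (B k) := fun k => by measurability
  let m : ℕ → MeasurableSpace Ω := fun i => MeasurableSpace.comap (ξ i) inferInstance
  have hmξ : ∀ (s : Set ℕ) (i : ℕ), i ∈ s → Measurable[⨆ j ∈ s, m j] (ξ i) := fun s i hi =>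
    (comap_measurable (ξ i)).mono (le_iSup₂_of_le i hi le_rfl) le_rfl
  have hind : ∀ k ≤ N, P (E k ∩ B k) = P (E k) * P (B k) := by
    intro k hk
    have hdis : Disjoint (Set.Iio k) (Set.Ici k) :=
      Set.disjoint_left.2 fun i hi hi' => (Set.mem_Iio.1 hi).not_ge hi'
    refine (Indep_iff _ _ _).1 (indep_iSup_of_disjoint (fun i => (hξ i).comap_le) hindep hdis)
      _ _ ?_ ?_
    · have hSk : ∀ j ≤ k, Measurable[⨆ i ∈ Set.Iio k, m i] (S j) := fun j hj =>
        @Finset.measurable_fun_sum _ _ _ _ _ _ (⨆ i ∈ Set.Iio k, m i) _ _ fun i hi =>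
          hmξ _ i ((Finset.mem_range.1 hi).trans_le hj)
      have : E k = S k ⁻¹' Set.Ioi (a + b) ∩ ⋂ j, ⋂ (_ : j < k), S j ⁻¹' Set.Iic (a + b) := by
        ext ω; simp [E]
      rw [this]
      exact MeasurableSet.inter (hSk k le_rfl measurableSet_Ioi)
        (MeasurableSet.iInter fun j => MeasurableSet.iInter fun hj =>
          hSk j hj.le measurableSet_Iic)
    · have hsum : ∀ ω, S N ω - S k ω = ∑ i ∈ Finset.Ico k N, ξ i ω := fun ω => by
        rw [Finset.sum_Ico_eq_sub _ hk]
      have : B k = (fun ω => ∑ i ∈ Finset.Ico k N, ξ i ω) ⁻¹' Set.Iio (-b) := by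
        ext ω; simp [B, hsum]
      rw [this]
      exact (@Finset.measurable_fun_sum _ _ _ _ _ _ (⨆ i ∈ Set.Ici k, m i) _ _ fun i hi =>
          hmξ _ i (Finset.mem_Ico.1 hi).1) measurableSet_Iio
  have hdisj : Pairwise (Function.onFun Disjoint E) := by
    intro j k hjk
    wlog hlt : j < k generalizing j k
    · exact (this hjk.symm (lt_of_le_of_ne (not_lt.1 hlt) hjk.symm)).symm
    exact Set.disjoint_left.2 fun ω hj hk => (hk.2 j hlt).not_gt hj.1
  have hA : {ω | ∃ k ≤ N, a + b < S k ω} ⊆ ⋃ k ∈ Finset.range (N + 1), E k := by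
    rintro ω ⟨k, hk, hω⟩
    classical
    have hex : ∃ k, a + b < S k ω := ⟨k, hω⟩
    refine Set.mem_iUnion₂.2 ⟨Nat.find hex, ?_, Nat.find_spec hex, fun j hj =>
      not_lt.1 (Nat.find_min hex hj)⟩
    exact Finset.mem_range.2 (Nat.lt_succ_of_le ((Nat.find_min' hex hω).trans hk))
  calc P {ω | ∃ k ≤ N, a + b < S k ω}
      ≤ P (⋃ k ∈ Finset.range (N + 1), E k) := measure_mono hA
    _ ≤ P ({ω | a < S N ω} ∪ ⋃ k ∈ Finset.range (N + 1), (E k ∩ B k)) := by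
        refine measure_mono (Set.iUnion₂_subset fun k hk ω hω => ?_)
        by_cases hB : ω ∈ B k
        · exact Or.inr (Set.mem_iUnion₂.2 ⟨k, hk, hω, hB⟩)
        · have h1 := hω.1
          have h2 : -b ≤ S N ω - S k ω := not_lt.1 hB
          exact Or.inl (show a < S N ω by linarith)
    _ ≤ P {ω | a < S N ω} + ∑ k ∈ Finset.range (N + 1), P (E k ∩ B k) :=
        (measure_union_le _ _).trans (by gcongr; exact measure_biUnion_finset_le _ _)
    _ ≤ P {ω | a < S N ω} + ∑ k ∈ Finset.range (N + 1), P (E k) * η := by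
        gcongr with k hk
        have hk' : k ≤ N := Nat.lt_succ_iff.1 (Finset.mem_range.1 hk)
        rw [hind k hk']
        gcongr
        exact h k hk'
    _ ≤ P {ω | a < S N ω} + 1 * η := by
        rw [← Finset.sum_mul, ← measure_biUnion_finset (fun i _ j _ hij => hdisj hij)
          fun k _ => hEm k]
        gcongr
        exact prob_le_one
    _ = _ := by rw [one_mul]

lemma tendsto_nnreal_nat_ceil_mul_div (α : ℝ≥0) :
    Tendsto (fun n : ℕ => (⌈α * n⌉₊ : ℝ≥0) / n) atTop (𝓝 α) := by
  rw [← NNReal.tendsto_coe]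
  refine ((tendsto_nat_ceil_mul_div_atTop α.2).comp tendsto_natCast_atTop_atTop).congr fun n => ?_
  have : ⌈(α : ℝ) * n⌉₊ = ⌈α * n⌉₊ := eq_of_forall_ge_iff fun k => by
    rw [Nat.ceil_le, Nat.ceil_le]
    norm_cast
  simp [this]

namespace IsLevyProcess

variable {Ω : Type*} [MeasurableSpace Ω] {P : Measure Ω} {X : ℝ≥0 → Ω → ℝ}

lemma affine (hX : IsLevyProcess X P) (c d : ℝ) :
    IsLevyProcess (fun t ω => c * X t ω + d * t) P where
  measurable t := ((hX.measurable t).const_mul c).add_const _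
  zero := hX.zero.mono fun ω h => by simp [h]
  indep n t ht := by
    convert (hX.indep n t ht).comp
      (fun i x => c * x + d * ((t i.succ : ℝ) - t i.castSucc)) (fun i => by fun_prop) using 1
    ext i ω
    simp only [Function.comp]
    ring
  stationary s t := by
    convert (hX.stationary s t).comp (u := fun x => c * x + d * t) (by fun_prop) using 1
    · ext ω
      simp only [Function.comp, NNReal.coe_add]
      ring
    · rfl
  cadlag := hX.cadlag.mono fun ω h =>
    (h.const_mul c).add (continuous_const.mul NNReal.continuous_coe).isCadlag

lemma neg (hX : IsLevyProcess X P) : IsLevyProcess (fun t ω => -X t ω) P := by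
  simpa using hX.affine (-1) 0

lemma measure_sub_mem (hX : IsLevyProcess X P) (s t : ℝ≥0) {A : Set ℝ} (hA : MeasurableSet A) :
    P {ω | X (s + t) ω - X s ω ∈ A} = P {ω | X t ω ∈ A} :=
  (hX.stationary s t).measure_mem_eq hA

/-- Ottaviani's maximal inequality for the increments of a Lévy process. -/
lemma measure_exists_sub_gt_le [IsProbabilityMeasure P] (hX : IsLevyProcess X P) (t₀ T : ℝ≥0)
    {a b : ℝ} {η : ℝ≥0∞} (h : ∀ s ≤ T, P {ω | X s ω < -b} ≤ η) :
    P {ω | ∃ t ≤ T, a + b < X (t₀ + t) ω - X t₀ ω} ≤ P {ω | a < X T ω} + η := by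
  obtain ⟨g, hgd⟩ : ∃ g : ℕ → ℕ → ℝ≥0, ∀ n k, g n k = t₀ + T * (k / n) := ⟨_, fun _ _ => rfl⟩
  have hg : ∀ n, Monotone (g n) := fun n i j hij => by simp only [hgd]; gcongr
  let A : ℕ → Set Ω := fun n => {ω | ∃ k ≤ n, a + b < X (g n k) ω - X (g n 0) ω}
  have hg0 : ∀ n, g n 0 = t₀ := fun n => by simp [hgd]
  have hgn : ∀ n, n ≠ 0 → g n n = t₀ + T := fun n hn => by
    simp only [hgd]; rw [div_self (by exact_mod_cast hn), mul_one]
  have hA : ∀ n, n ≠ 0 → P (A n) ≤ P {ω | a < X T ω} + η := by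
    intro n hn
    have hs : ∀ k ω, ∑ i ∈ Finset.range k, (X (g n (i + 1)) ω - X (g n i) ω) =
        X (g n k) ω - X (g n 0) ω := fun k ω => Finset.sum_range_sub (fun i => X (g n i) ω) k
    have := (hX.indep.nat (hg n)).measure_exists_sum_gt_le (N := n) (a := a) (b := b) (η := η)
      (fun i => (hX.measurable _).sub (hX.measurable _)) (by
        intro k hk
        simp only [Pi.sub_apply, hs, sub_sub_sub_cancel_right]
        obtain ⟨r, hr⟩ := exists_add_of_le (hg n hk)
        rw [hr]
        refine (hX.measure_sub_mem (g n k) r (measurableSet_Iio (a := -b))).trans_le (h r ?_)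
        rw [hgn n hn] at hr
        have h0 : t₀ ≤ g n k := (hg0 n).symm.le.trans (hg n k.zero_le)
        have : t₀ + r ≤ t₀ + T := by rw [hr]; gcongr
        exact le_of_add_le_add_left this)
    simp only [Pi.sub_apply, hs, hg0, hgn n hn] at this
    refine le_trans (by simp only [A, hg0]; rfl) (this.trans_eq ?_)
    exact congrArg (· + η) (hX.measure_sub_mem t₀ T (measurableSet_Ioi (a := a)))
  -- The grids are not nested, so a liminf of events is needed: an exceedance at `t₀ + T α` is seen,
  -- by right continuity, at the grid points of index `⌈α n⌉` for all large `n`.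
  have hsub : ∀ᵐ ω ∂P, (∃ t ≤ T, a + b < X (t₀ + t) ω - X t₀ ω) →
      ω ∈ ⋃ m, ⋂ n, ⋂ (_ : m ≤ n), A n := by
    filter_upwards [hX.cadlag] with ω hω
    rintro ⟨t, ht, hlt⟩
    obtain ⟨α, hα, rfl⟩ : ∃ α ≤ 1, T * α = t := by
      rcases eq_or_ne T 0 with rfl | hT
      · exact ⟨0, zero_le_one, by simpa using (le_antisymm ht zero_le).symm⟩
      · exact ⟨t / T, div_le_one_of_le₀ ht zero_le, mul_div_cancel₀ _ hT⟩
    have h1 : Tendsto (fun n : ℕ => g n ⌈α * n⌉₊) atTop (𝓝[≥] (t₀ + T * α)) := by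
      refine tendsto_nhdsWithin_iff.2 ⟨?_, ?_⟩
      · simp only [hgd]
        refine tendsto_const_nhds.add (tendsto_const_nhds.mul ?_)
        exact tendsto_nnreal_nat_ceil_mul_div α
      · filter_upwards [eventually_ne_atTop 0] with n hn
        simp only [hgd, Set.mem_Ici]
        gcongr
        rw [le_div_iff₀ (by positivity)]
        exact Nat.le_ceil _
    have h2 := (((hω (t₀ + T * α)).1.tendsto.comp h1).sub_const (X t₀ ω)).eventually_const_lt hlt
    obtain ⟨m, hm⟩ := eventually_atTop.1 h2
    refine Set.mem_iUnion.2 ⟨m, Set.mem_iInter₂.2 fun n hn => ⟨⌈α * n⌉₊, ?_, ?_⟩⟩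
    · exact Nat.ceil_le.2 (mul_le_of_le_one_left zero_le hα)
    · rw [hg0]; exact hm n hn
  calc _ ≤ P (⋃ m, ⋂ n, ⋂ (_ : m ≤ n), A n) := measure_mono_ae hsub
    _ = ⨆ m, P (⋂ n, ⋂ (_ : m ≤ n), A n) := by
        refine Monotone.measure_iUnion fun m m' hm => ?_
        exact Set.iInter_mono fun n => Set.iInter_mono' fun h => ⟨hm.trans h, subset_rfl⟩
    _ ≤ _ := by
        refine iSup_le fun m => ?_
        -- The index `m + 1` avoids the degenerate grid `n = 0`.
        exact (measure_mono (Set.iInter₂_subset (m + 1) m.le_succ)).trans (hA _ m.succ_ne_zero)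

/-- Two-sided maximal inequality for the increments of a Lévy process. -/
lemma measure_exists_abs_sub_gt_le [IsProbabilityMeasure P] (hX : IsLevyProcess X P) (t₀ T : ℝ≥0)
    {a : ℝ} {η : ℝ≥0∞} (h : ∀ s ≤ T, P {ω | a < |X s ω|} ≤ η) :
    P {ω | ∃ t ≤ T, 2 * a < |X (t₀ + t) ω - X t₀ ω|} ≤ 4 * η := by
  have hpos : ∀ s ≤ T, P {ω | a < X s ω} ≤ η := fun s hs =>
    (measure_mono fun ω (hω : a < X s ω) => hω.trans_le (le_abs_self _)).trans (h s hs)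
  have hneg : ∀ s ≤ T, P {ω | X s ω < -a} ≤ η := fun s hs =>
    (measure_mono fun ω (hω : X s ω < -a) =>
      (lt_neg_of_lt_neg hω).trans_le (neg_le_abs _)).trans (h s hs)
  have h1 := hX.measure_exists_sub_gt_le t₀ T (a := a) hneg
  have h2 := hX.neg.measure_exists_sub_gt_le t₀ T (a := a) (b := a) (η := η)
    (by simpa using hpos)
  calc _ ≤ P ({ω | ∃ t ≤ T, a + a < X (t₀ + t) ω - X t₀ ω} ∪
        {ω | ∃ t ≤ T, a + a < -X (t₀ + t) ω - -X t₀ ω}) := by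
        refine measure_mono ?_
        rintro ω ⟨t, ht, hω⟩
        rcases lt_abs.1 hω with h | h
        · exact Or.inl ⟨t, ht, by linarith⟩
        · exact Or.inr ⟨t, ht, by linarith⟩
    _ ≤ (η + η) + (η + η) := by
        refine (measure_union_le _ _).trans (add_le_add (h1.trans ?_) (h2.trans ?_))
        · gcongr; exact hpos T le_rfl
        · gcongr
          refine (measure_mono fun ω hω => ?_).trans (hneg T le_rfl)
          exact lt_neg_of_lt_neg (show a < -X T ω from hω)
    _ = 4 * η := by ring

lemma ae_tendsto_div [IsProbabilityMeasure P] (hX : IsLevyProcess X P)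
    (hint : Integrable (X 1) P) :
    ∀ᵐ ω ∂P, Tendsto (fun n : ℕ => X n ω / n) atTop (𝓝 (∫ ω, X 1 ω ∂P)) := by
  let ξ : ℕ → Ω → ℝ := fun i ω => X ((i + 1 : ℕ) : ℝ≥0) ω - X (i : ℝ≥0) ω
  have hid : ∀ i, IdentDistrib (ξ i) (X 1) P P := fun i => by
    simpa [ξ] using hX.stationary i 1
  have hind : iIndepFun ξ P := hX.indep.nat (t := fun n : ℕ => (n : ℝ≥0)) Nat.mono_cast
  have := strong_law_ae_real ξ ((hid 0).integrable_iff.2 hint)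
    (fun i j hij => hind.indepFun hij) (fun i => (hid i).trans (hid 0).symm)
  rw [(hid 0).integral_eq] at this
  filter_upwards [this, hX.zero] with ω hω h0
  refine hω.congr fun n => ?_
  simp only [ξ]
  rw [Finset.sum_range_sub (fun i : ℕ => X (i : ℝ≥0) ω)]
  simp [h0]

end IsLevyProcess

/-! ### Tightness of suprema -/

section Tightness

variable {Ω : Type*} [MeasurableSpace Ω] {P : Measure Ω} [IsProbabilityMeasure P]

/-- The supremum of an almost surely bounded countable family is tight. -/
lemma exists_measure_exists_gt_le {ι : Type*} [Countable ι] {Z : ι → Ω → ℝ}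
    (hZ : ∀ i, Measurable (Z i)) (hb : ∀ᵐ ω ∂P, ∃ K : ℝ, ∀ i, Z i ω ≤ K) {η : ℝ≥0∞}
    (hη : η ≠ 0) : ∃ K : ℝ, 0 < K ∧ P {ω | ∃ i, K < Z i ω} ≤ η := by
  let A : ℕ → Set Ω := fun n => {ω | ∃ i, (n : ℝ) + 1 < Z i ω}
  have hA : ∀ n, MeasurableSet (A n) := fun n => by
    have : A n = ⋃ i, {ω | (n : ℝ) + 1 < Z i ω} := by ext; simp [A]
    rw [this]
    exact MeasurableSet.iUnion fun i => measurableSet_lt measurable_const (hZ i)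
  have hanti : Antitone A := by
    rintro n m hnm ω ⟨i, hi⟩
    exact ⟨i, lt_of_le_of_lt (by gcongr) hi⟩
  have h0 : P (⋂ n, A n) = 0 := by
    rw [measure_eq_zero_iff_ae_notMem]
    filter_upwards [hb] with ω ⟨K, hK⟩ hω
    obtain ⟨n, hn⟩ := exists_nat_gt K
    obtain ⟨i, hi⟩ := Set.mem_iInter.1 hω n
    linarith [hK i]
  have hlim := tendsto_measure_iInter_atTop (fun n => (hA n).nullMeasurableSet) hanti
    ⟨0, measure_ne_top P _⟩
  rw [h0] at hlim
  obtain ⟨n, hn⟩ := (hlim.eventually_le_const (pos_iff_ne_zero.2 hη)).exists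
  exact ⟨n + 1, by positivity, hn⟩

/-- The supremum of a càdlàg process over an open set of times is tight if it is almost surely
finite. -/
lemma exists_measure_exists_mem_gt_le {Z : ℝ≥0 → Ω → ℝ} (hZ : ∀ t, Measurable (Z t))
    (hcad : ∀ᵐ ω ∂P, IsCadlag fun t => Z t ω) {S : Set ℝ≥0} (hS : IsOpen S)
    (hb : ∀ᵐ ω ∂P, ∃ K : ℝ, ∀ t ∈ S, Z t ω ≤ K) {η : ℝ≥0∞} (hη : η ≠ 0) :
    ∃ K : ℝ, 0 < K ∧ P {ω | ∃ t ∈ S, K < Z t ω} ≤ η := by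
  obtain ⟨K, hK, h⟩ := exists_measure_exists_gt_le (P := P)
    (ι := {n // TopologicalSpace.denseSeq ℝ≥0 n ∈ S})
    (Z := fun n => Z (TopologicalSpace.denseSeq ℝ≥0 n)) (fun n => hZ _)
    (hb.mono fun ω ⟨K, hK⟩ => ⟨K, fun n => hK _ n.2⟩) hη
  refine ⟨K, hK, le_trans (measure_mono_ae ?_) h⟩
  filter_upwards [hcad] with ω hω
  rintro ⟨t, ht, hlt⟩
  obtain ⟨n, -, hn, hn'⟩ := hω.exists_denseSeq_gt hlt (hS.mem_nhds ht)
  exact ⟨⟨n, hn⟩, hn'⟩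

end Tightness

/-! ### Uniform estimates for centered Lévy processes -/

lemma IsCadlag.abs {f : ℝ≥0 → ℝ} (hf : IsCadlag f) : IsCadlag (fun t => |f t|) := fun t =>
  ⟨(hf t).1.abs, let ⟨l, hl⟩ := (hf t).2; ⟨|l|, hl.abs⟩⟩

namespace IsLevyProcess

variable {Ω : Type*} [MeasurableSpace Ω] {P : Measure Ω} {X : ℝ≥0 → Ω → ℝ}

/-- Splitting a Lévy process at the integer part of the time. -/
lemma measure_abs_gt_le_floor (hX : IsLevyProcess X P) (s : ℝ≥0) {a b : ℝ} :
    P {ω | a + b < |X s ω|} ≤ P {ω | a < |X ⌊s⌋₊ ω|} + P {ω | b < |X (s - ⌊s⌋₊) ω|} := by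
  have hs : (⌊s⌋₊ : ℝ≥0) + (s - ⌊s⌋₊) = s := add_tsub_cancel_of_le (Nat.floor_le zero_le)
  have hm : MeasurableSet {x : ℝ | b < |x|} := measurableSet_lt measurable_const (by fun_prop)
  have := hX.measure_sub_mem ⌊s⌋₊ (s - ⌊s⌋₊) hm
  rw [hs] at this
  refine le_trans (measure_mono fun ω hω => ?_)
    ((measure_union_le _ _).trans (add_le_add le_rfl this.le))
  by_contra hcon
  have h1 : |X ⌊s⌋₊ ω| ≤ a := not_lt.1 fun h => hcon (Or.inl h)
  have h2 : |X s ω - X ⌊s⌋₊ ω| ≤ b := not_lt.1 fun h => hcon (Or.inr h)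
  have h3 : a + b < |X s ω| := hω
  have h4 := abs_add_le (X ⌊s⌋₊ ω) (X s ω - X ⌊s⌋₊ ω)
  rw [add_sub_cancel] at h4
  linarith

variable [IsProbabilityMeasure P]

/-- Controls the fractional part of the time when a general time is reduced to an integer one. The
open set `[0, 2)` contains `[0, 1]`, and paths are bounded on it. -/
lemma exists_measure_abs_gt_le (hX : IsLevyProcess X P) {η : ℝ≥0∞} (hη : η ≠ 0) :
    ∃ K : ℝ, 0 < K ∧ ∀ r ≤ 1, P {ω | K < |X r ω|} ≤ η := by
  obtain ⟨K, hK, h⟩ := exists_measure_exists_mem_gt_le (P := P) (Z := fun t ω => |X t ω|)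
    (S := Set.Iio 2) (fun t => (hX.measurable t).abs) (hX.cadlag.mono fun ω h => h.abs) isOpen_Iio
    (hX.cadlag.mono fun ω h => (h.exists_abs_le 2).imp fun K hK t ht => hK t (le_of_lt ht)) hη
  refine ⟨K, hK, fun r hr => (measure_mono fun ω hω => ?_).trans h⟩
  exact ⟨r, hr.trans_lt one_lt_two, hω⟩

lemma sub_floor_le (s : ℝ≥0) : s - ⌊s⌋₊ ≤ 1 :=
  tsub_le_iff_left.2 (Nat.lt_floor_add_one s).le

/-- A weak law of large numbers, uniform over a time interval, for centered Lévy processes. -/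
lemma eventually_measure_exists_abs_gt_le (hX : IsLevyProcess X P) (hint : Integrable (X 1) P)
    (hmean : ∫ ω, X 1 ω ∂P = 0) {δ : ℝ} (hδ : 0 < δ) {η : ℝ≥0∞} (hη : η ≠ 0) :
    ∀ᶠ n : ℕ in atTop, P {ω | ∃ t ≤ (n : ℝ≥0), δ * n < |X t ω|} ≤ η := by
  have hη8 : η / 4 / 2 ≠ 0 := by simp [hη, ENNReal.div_eq_zero_iff]
  -- By the strong law `|X k| - (δ/4) k` is almost surely bounded above in `k`; tightness gives a
  -- constant valid for all integers at once.
  obtain ⟨K₁, -, h₁⟩ := exists_measure_exists_gt_le (P := P)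
    (Z := fun (k : ℕ) ω => |X k ω| - δ / 4 * k) (η := η / 4 / 2)
    (fun k => ((hX.measurable k).abs).sub_const _) (by
      filter_upwards [hX.ae_tendsto_div hint] with ω hω
      rw [hmean] at hω
      obtain ⟨N, hN⟩ := eventually_atTop.1
        ((hω.abs.eventually_lt_const (by rw [abs_zero]; positivity : |(0 : ℝ)| < δ / 4)).and
          (eventually_gt_atTop 0))
      obtain ⟨K, hK⟩ := ((Set.finite_Iio N).image
        fun k : ℕ => |X k ω| - δ / 4 * k).bddAbove
      refine ⟨max K 0, fun k => ?_⟩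
      rcases lt_or_ge k N with hk | hk
      · exact (hK ⟨k, hk, rfl⟩).trans (le_max_left _ _)
      · obtain ⟨h1, h2⟩ := hN k hk
        have h2' : (0 : ℝ) < k := by exact_mod_cast h2
        rw [abs_div, Nat.abs_cast, div_lt_iff₀ h2'] at h1
        exact (by linarith : |X k ω| - δ / 4 * k ≤ 0).trans (le_max_right _ _)) hη8
  obtain ⟨K₂, -, h₂⟩ := hX.exists_measure_abs_gt_le hη8
  have hbig : ∀ᶠ n : ℕ in atTop, K₁ + K₂ ≤ δ / 4 * n :=
    (tendsto_natCast_atTop_atTop.const_mul_atTop (by positivity)).eventually_ge_atTop _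
  filter_upwards [hbig] with n hn
  have hmarg : ∀ s ≤ (n : ℝ≥0), P {ω | δ / 2 * n < |X s ω|} ≤ η / 4 := by
    intro s hs
    have hk : (⌊s⌋₊ : ℝ) ≤ n := by exact_mod_cast (Nat.floor_le zero_le).trans hs
    calc P {ω | δ / 2 * n < |X s ω|}
        ≤ P {ω | (K₁ + δ / 4 * ⌊s⌋₊) + K₂ < |X s ω|} := by
          refine measure_mono fun ω (hω : δ / 2 * n < |X s ω|) => lt_of_le_of_lt ?_ hω
          nlinarith
      _ ≤ _ := hX.measure_abs_gt_le_floor s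
      _ ≤ η / 4 / 2 + η / 4 / 2 := by
          refine add_le_add ((measure_mono fun ω hω => ?_).trans h₁) (h₂ _ (sub_floor_le s))
          exact ⟨⌊s⌋₊, lt_sub_iff_add_lt.2 hω⟩
      _ = η / 4 := ENNReal.add_halves _
  calc P {ω | ∃ t ≤ (n : ℝ≥0), δ * n < |X t ω|}
      ≤ P {ω | ∃ t ≤ (n : ℝ≥0), 2 * (δ / 2 * n) < |X (0 + t) ω - X 0 ω|} := by
        refine measure_mono_ae ?_
        filter_upwards [hX.zero] with ω h0
        rintro ⟨t, ht, hlt⟩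
        refine ⟨t, ht, ?_⟩
        rw [zero_add, h0, sub_zero]
        linarith
    _ ≤ 4 * (η / 4) := hX.measure_exists_abs_sub_gt_le 0 n hmarg
    _ = η := ENNReal.mul_div_cancel (by simp) (by simp)

/-- Chebyshev's inequality for a centered Lévy process at integer times. -/
lemma measure_abs_natCast_ge_le (hX : IsLevyProcess X P) (hL2 : MemLp (X 1) 2 P)
    (hmean : ∫ ω, X 1 ω ∂P = 0) (k : ℕ) {c : ℝ} (hc : 0 < c) :
    P {ω | c ≤ |X k ω|} ≤ ENNReal.ofReal (k * Var[X 1; P] / c ^ 2) := by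
  let ξ : ℕ → Ω → ℝ := fun i ω => X ((i + 1 : ℕ) : ℝ≥0) ω - X (i : ℝ≥0) ω
  have hid : ∀ i, IdentDistrib (ξ i) (X 1) P P := fun i => by
    simpa [ξ] using hX.stationary i 1
  have hind : iIndepFun ξ P := hX.indep.nat (t := fun n : ℕ => (n : ℝ≥0)) Nat.mono_cast
  have hξ2 : ∀ i, MemLp (ξ i) 2 P := fun i => (hid i).memLp_iff.2 hL2
  have hvar : Var[∑ i ∈ Finset.range k, ξ i; P] = k * Var[X 1; P] := by
    rw [IndepFun.variance_sum (fun i _ => hξ2 i) fun i _ j _ hij => hind.indepFun hij]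
    simp [fun i => (hid i).variance_eq]
  have hmean' : ∫ ω, (∑ i ∈ Finset.range k, ξ i) ω ∂P = 0 := by
    simp only [Finset.sum_apply]
    rw [integral_finsetSum _ fun i _ => (hξ2 i).integrable one_le_two]
    simp [fun i => (hid i).integral_eq, hmean]
  have := meas_ge_le_variance_div_sq (memLp_finsetSum' (Finset.range k) fun i _ => hξ2 i) hc
  rw [hvar, hmean'] at this
  refine le_trans (measure_mono_ae ?_) this
  filter_upwards [hX.zero] with ω h0 hω
  have : (∑ i ∈ Finset.range k, ξ i) ω = X k ω := by
    simp only [Finset.sum_apply, ξ]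
    rw [Finset.sum_range_sub (fun i : ℕ => X (i : ℝ≥0) ω)]
    simp [h0]
  change c ≤ |(∑ i ∈ Finset.range k, ξ i) ω - 0|
  rw [this, sub_zero]
  exact hω

/-- Diffusive modulus of continuity of a centered square integrable Lévy process. -/
lemma exists_eventually_measure_exists_abs_sub_gt_le (hX : IsLevyProcess X P)
    (hL2 : MemLp (X 1) 2 P) (hmean : ∫ ω, X 1 ω ∂P = 0) {δ : ℝ} (hδ : 0 < δ) {η : ℝ≥0∞}
    (hη : η ≠ 0) :
    ∃ ε : ℝ, 0 < ε ∧ ∀ᶠ u : ℝ in atTop, ∀ t₀ T : ℝ≥0, (T : ℝ) ≤ ε * u →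
      P {ω | ∃ t ≤ T, δ * √u < |X (t₀ + t) ω - X t₀ ω|} ≤ η := by
  have hη8 : η / 4 / 2 ≠ 0 := by simp [hη, ENNReal.div_eq_zero_iff]
  obtain ⟨K, hK, h₂⟩ := hX.exists_measure_abs_gt_le hη8
  -- Chebyshev at level `(δ/4)√u` and integer time at most `ε u` gives exactly this bound,
  -- independent of `u`.
  have hlim : Tendsto (fun ε : ℝ => ENNReal.ofReal (ε * (Var[X 1; P] / (δ / 4) ^ 2)))
      (𝓝[>] 0) (𝓝 0) := by
    have : Tendsto (fun ε : ℝ => ε * (Var[X 1; P] / (δ / 4) ^ 2)) (𝓝 0) (𝓝 0) := by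
      simpa using (tendsto_id (α := ℝ) (x := 𝓝 0)).mul_const (Var[X 1; P] / (δ / 4) ^ 2)
    simpa using ENNReal.tendsto_ofReal (this.mono_left nhdsWithin_le_nhds)
  obtain ⟨ε, hε, hε0⟩ := ((hlim.eventually_le_const (pos_iff_ne_zero.2 hη8)).and
    self_mem_nhdsWithin).exists
  refine ⟨ε, hε0, ?_⟩
  have hbig : ∀ᶠ u : ℝ in atTop, K ≤ δ / 4 * √u :=
    (Real.tendsto_sqrt_atTop.const_mul_atTop (by positivity)).eventually_ge_atTop _
  filter_upwards [hbig, eventually_gt_atTop 0] with u hu hu0 t₀ T hT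
  have hsq : 0 < √u := Real.sqrt_pos.2 hu0
  have hmarg : ∀ s ≤ T, P {ω | δ / 2 * √u < |X s ω|} ≤ η / 4 := by
    intro s hs
    have hk : (⌊s⌋₊ : ℝ) ≤ ε * u :=
      le_trans (by exact_mod_cast (Nat.floor_le zero_le).trans hs) hT
    calc P {ω | δ / 2 * √u < |X s ω|}
        ≤ P {ω | δ / 4 * √u + K < |X s ω|} := by
          refine measure_mono fun ω (hω : δ / 2 * √u < |X s ω|) => lt_of_le_of_lt ?_ hω
          linarith
      _ ≤ _ := hX.measure_abs_gt_le_floor s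
      _ ≤ η / 4 / 2 + η / 4 / 2 := by
          refine add_le_add ?_ (h₂ _ (sub_floor_le s))
          refine (measure_mono fun ω (hω : δ / 4 * √u < |X ⌊s⌋₊ ω|) => le_of_lt hω).trans
            ((hX.measure_abs_natCast_ge_le hL2 hmean ⌊s⌋₊
              (c := δ / 4 * √u) (by positivity)).trans
              (le_trans (ENNReal.ofReal_le_ofReal ?_) hε))
          rw [mul_pow, Real.sq_sqrt hu0.le, div_le_iff₀ (by positivity)]
          have hv := variance_nonneg (X 1) P
          calc ⌊s⌋₊ * Var[X 1; P] ≤ ε * u * Var[X 1; P] := by gcongr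
            _ = _ := by field_simp
      _ = η / 4 := ENNReal.add_halves _
  have := hX.measure_exists_abs_sub_gt_le t₀ T hmarg
  rwa [ENNReal.mul_div_cancel (by simp) (by simp), ← mul_assoc, mul_div_cancel₀ δ two_ne_zero]
    at this

end IsLevyProcess

/-! ### Measurability of the first passage time -/

lemma tau_eq_iInf_denseSeq {Ω : Type*} {f : ℝ≥0 → ℝ} {X : ℝ≥0 → Ω → ℝ} (hf : IsCadlag f) {ω : Ω}
    (hω : IsCadlag fun t => X t ω) (u : ℝ) :
    tau f X u ω = ⨅ p : {p : ℕ × ℕ // TopologicalSpace.denseSeq ℝ≥0 p.1 ≤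
        TopologicalSpace.denseSeq ℝ≥0 p.2},
      open Classical in if u < X (TopologicalSpace.denseSeq ℝ≥0 p.1.2) ω ∨
        u < X (TopologicalSpace.denseSeq ℝ≥0 p.1.2) ω - X (TopologicalSpace.denseSeq ℝ≥0 p.1.1) ω +
          f (TopologicalSpace.denseSeq ℝ≥0 p.1.1)
      then (TopologicalSpace.denseSeq ℝ≥0 p.1.2 : ℝ≥0∞) else ∞ := by
  set d := TopologicalSpace.denseSeq ℝ≥0
  refine le_antisymm (le_iInf fun ⟨⟨i, j⟩, hij⟩ => ?_) (le_of_forall_gt fun T hT => ?_)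
  · split_ifs with h
    · refine passageTime_le ((lt_reflect_iff hf hω).2 (h.imp_right fun h => ⟨d i, hij, h⟩))
    · exact le_top
  · obtain ⟨t, htT, ht⟩ := exists_of_passageTime_lt hT
    obtain ⟨R, htR, hRT⟩ := ENNReal.lt_iff_exists_nnreal_btwn.1 htT
    have htR' : t < R := by exact_mod_cast htR
    suffices ∃ i j, d i ≤ d j ∧ d j < R ∧ (u < X (d j) ω ∨ u < X (d j) ω - X (d i) ω + f (d i)) by
      obtain ⟨i, j, hij, hj, h⟩ := this
      refine (iInf_le _ ⟨(i, j), hij⟩).trans_lt ?_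
      rw [if_pos h]
      exact lt_trans (by exact_mod_cast hj) hRT
    rcases (lt_reflect_iff hf hω).1 ht with h | ⟨s, hst, h⟩
    · obtain ⟨j, -, hj, hj'⟩ := hω.exists_denseSeq_gt h (Iio_mem_nhds htR')
      exact ⟨j, j, le_rfl, hj, Or.inl hj'⟩
    -- When `s = t` both terms in `x` cancel and a single dense time right of `t` serves. When `s <
    -- t`, `i` is chosen first, with time in `(s, t)`, then `j` beyond `t`, which keeps the order.
    · rcases hst.eq_or_lt with rfl | hst
      · obtain ⟨j, -, hj, hj'⟩ := hf.exists_denseSeq_gt (by linarith : u < f s)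
          (Iio_mem_nhds htR')
        exact ⟨j, j, le_rfl, hj, Or.inr (by linarith)⟩
      · obtain ⟨i, -, hi, hi'⟩ := (hf.sub hω).exists_denseSeq_gt
          (by linarith : u - X t ω < f s - X s ω) (Iio_mem_nhds hst)
        obtain ⟨j, hj, hjR, hj'⟩ := hω.exists_denseSeq_gt
          (by linarith : u - (f (d i) - X (d i) ω) < X t ω) (Iio_mem_nhds htR')
        exact ⟨i, j, (hi.trans hj).le, hjR, Or.inr (by linarith)⟩

lemma aemeasurable_tau {Ω : Type*} [MeasurableSpace Ω] {P : Measure Ω} {f : ℝ≥0 → ℝ}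
    {X : ℝ≥0 → Ω → ℝ} (hf : IsCadlag f) (hX : IsLevyProcess X P) (u : ℝ) :
    AEMeasurable (tau f X u) P := by
  refine ⟨_, ?_, hX.cadlag.mono fun ω hω => tau_eq_iInf_denseSeq hf hω u⟩
  refine Measurable.iInf fun p => Measurable.ite ?_ measurable_const measurable_const
  have := hX.measurable
  exact (measurableSet_lt measurable_const (this _)).union
    (measurableSet_lt measurable_const (((this _).sub (this _)).add_const _))

/-! ### Pathwise localization of the passage time -/

/-- If `x t - m * t` is within `e` of `c` on a time window containing the first passage time over
`u`, and the barrier exceeds `x` by at most `K`, then the first passage time is close to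
`(u - c) / m`. -/
lemma abs_toReal_passageTime_sub_le {f x : ℝ≥0 → ℝ} (hf : IsCadlag f) (hx : IsCadlag x)
    {m c e K u A B : ℝ} (hm : 0 < m) (hK : 0 ≤ K) (hfx : ∀ t, f t - x t ≤ K)
    (hwin : ∀ t : ℝ≥0, A ≤ t → t ≤ B → |x t - m * t - c| ≤ e)
    (hfin : passageTime (reflect f x) u < ∞)
    (h0 : 0 < (passageTime (reflect f x) u).toReal ∨ c ≤ u + e)
    (hA : A < (passageTime (reflect f x) u).toReal)
    (hB : (passageTime (reflect f x) u).toReal < B) :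
    |m * (passageTime (reflect f x) u).toReal + c - u| ≤ e + K := by
  have hbelow : ∀ t : ℝ≥0, (t : ℝ) < (passageTime (reflect f x) u).toReal → x t ≤ u :=
    fun t ht => not_lt.1 fun h =>
      (le_of_lt_toReal_passageTime hfin ht).not_gt ((lt_reflect_iff hf hx).2 (Or.inl h))
  have habove := fun T hT => exists_of_toReal_passageTime_lt (T := T) hfin hT
  have hτ0 : 0 ≤ (passageTime (reflect f x) u).toReal := ENNReal.toReal_nonneg
  generalize (passageTime (reflect f x) u).toReal = τ at *
  refine abs_le.2 ⟨?_, ?_⟩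
  -- Too early: just after `τ` the path is still below `u - K`, which neither `x` nor the barrier
  -- can compensate.
  · by_contra! hlt
    have hlt' : τ < (u - c - e - K) / m := by rw [lt_div_iff₀ hm]; linarith
    obtain ⟨t, ht1, ht2, hut⟩ := habove (min B ((u - c - e - K) / m)) (lt_min hB hlt')
    have hx1 := (abs_le.1 (hwin t (hA.le.trans ht1) (ht2.le.trans (min_le_left _ _)))).2
    have ht3 := (lt_div_iff₀ hm).1 (ht2.trans_le (min_le_right _ _))
    rcases (lt_reflect_iff hf hx).1 hut with h | ⟨s, -, h⟩
    · linarith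
    · linarith [hfx s]
  -- Too late: at a time `z` before `τ` the path itself is already above `u`. Such a `z` needs `τ >
  -- 0`, whence `h0`.
  · suffices m * τ + c - u ≤ e by linarith
    by_contra! hlt
    have hτ : 0 < τ := by
      rcases h0 with h | h
      · exact h
      · by_contra hneg
        have : τ = 0 := le_antisymm (not_lt.1 hneg) hτ0
        subst this
        linarith
    have hlt' : (u + e - c) / m < τ := by rw [div_lt_iff₀ hm]; linarith
    obtain ⟨z, hz1, hz2⟩ := exists_between (max_lt hτ (max_lt hA hlt'))
    lift z to ℝ≥0 using ((le_max_left _ _).trans hz1.le)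
    have hzA : A ≤ z := (le_max_left _ _).trans ((le_max_right _ _).trans hz1.le)
    have hz3 : (u + e - c) / m < z :=
      (le_max_right _ _).trans_lt ((le_max_right _ _).trans_lt hz1)
    rw [div_lt_iff₀ hm] at hz3
    have := (abs_le.1 (hwin z hzA (hz2.le.trans hB.le))).1
    linarith [hbelow z hz2]

lemma tendstoInMeasure_real_of_forall {Ω ι : Type*} [MeasurableSpace Ω] {P : Measure Ω}
    {l : Filter ι} {Z : ι → Ω → ℝ} {W : Ω → ℝ}
    (h : ∀ ε : ℝ, 0 < ε → ∀ η : ℝ≥0∞, η ≠ 0 → ∀ᶠ i in l, P {ω | ε ≤ |Z i ω - W ω|} ≤ η) :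
    TendstoInMeasure P Z l W := by
  rw [tendstoInMeasure_iff_norm]
  exact fun ε hε => ENNReal.tendsto_nhds_zero.2 fun η hη => h ε hε η hη.ne'

lemma MeasureTheory.TendstoInMeasure.eventually_measure_le {Ω ι : Type*} [MeasurableSpace Ω]
    {P : Measure Ω} {l : Filter ι} {Z : ι → Ω → ℝ} {W : Ω → ℝ} (h : TendstoInMeasure P Z l W)
    {ε : ℝ} (hε : 0 < ε) {η : ℝ≥0∞} (hη : η ≠ 0) :
    ∀ᶠ i in l, P {ω | ε ≤ |Z i ω - W ω|} ≤ η := by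
  rw [tendstoInMeasure_iff_norm] at h
  exact ENNReal.tendsto_nhds_zero.1 (h ε hε) η (pos_iff_ne_zero.2 hη)

/-! ### Law of large numbers when the process escapes above the barrier -/

namespace IsLevyProcess

variable {Ω : Type*} [MeasurableSpace Ω] {P : Measure Ω} {X : ℝ≥0 → Ω → ℝ} {f : ℝ≥0 → ℝ}

/-- Subtracting the mean drift. -/
lemma centered (hX : IsLevyProcess X P) (m : ℝ) :
    IsLevyProcess (fun t ω => X t ω - m * t) P := by
  simpa [sub_eq_add_neg] using hX.affine 1 (-m)

lemma integral_centered [IsProbabilityMeasure P] (hint : Integrable (X 1) P) :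
    ∫ ω, (X 1 ω - (∫ ω, X 1 ω ∂P) * (1 : ℝ≥0)) ∂P = 0 := by
  rw [integral_sub hint (integrable_const _)]
  simp

variable [IsProbabilityMeasure P]

lemma ae_tau_lt_top (hX : IsLevyProcess X P) (hint : Integrable (X 1) P)
    (hmean : 0 < ∫ ω, X 1 ω ∂P) (hf : IsCadlag f) (u : ℝ) : ∀ᵐ ω ∂P, tau f X u ω < ∞ := by
  filter_upwards [hX.ae_tendsto_div hint, hX.cadlag] with ω hω hcad
  have h1 : Tendsto (fun n : ℕ => X n ω / n * n) atTop atTop :=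
    hω.pos_mul_atTop hmean tendsto_natCast_atTop_atTop
  obtain ⟨n, hn, hn0⟩ := ((h1.eventually_gt_atTop u).and (eventually_ne_atTop 0)).exists
  rw [div_mul_cancel₀ _ (by exact_mod_cast hn0)] at hn
  exact (passageTime_le ((lt_reflect_iff hf hcad).2 (Or.inl hn))).trans_lt ENNReal.coe_lt_top

lemma exists_measure_barrier_gt_le (hX : IsLevyProcess X P) (hf : IsCadlag f)
    (hlim : ∀ᵐ ω ∂P, Tendsto (fun t => X t ω - f t) atTop atTop) {η : ℝ≥0∞} (hη : η ≠ 0) :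
    ∃ K : ℝ, 0 < K ∧ P {ω | ∃ t, K < f t - X t ω} ≤ η := by
  obtain ⟨K, hK, h⟩ := exists_measure_exists_mem_gt_le (P := P) (Z := fun t ω => f t - X t ω)
    (fun t => (hX.measurable t).const_sub _) (hX.cadlag.mono fun ω h => hf.sub h) isOpen_univ
    (by
      filter_upwards [hX.cadlag, hlim] with ω hω hl
      obtain ⟨T, hT⟩ := eventually_atTop.1 (hl.eventually_ge_atTop 0)
      obtain ⟨K, hK⟩ := (hf.sub hω).exists_abs_le T
      refine ⟨max K 0, fun t _ => ?_⟩
      rcases le_total t T with h | h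
      · exact ((le_abs_self _).trans (hK t h)).trans (le_max_left _ _)
      · exact le_max_of_le_right (by linarith [hT t h])) hη
  exact ⟨K, hK, by simpa using h⟩

/-- Weak law of large numbers for the first passage times when the process escapes above the
barrier. -/
lemma tendstoInMeasure_tau_div (hX : IsLevyProcess X P) (hint : Integrable (X 1) P)
    (hmean : 0 < ∫ ω, X 1 ω ∂P) (hf : IsCadlag f)
    (hlim : ∀ᵐ ω ∂P, Tendsto (fun t => X t ω - f t) atTop atTop) :
    TendstoInMeasure P (fun (u : ℝ) ω => (tau f X u ω).toReal / u) atTop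
      (fun _ => 1 / ∫ ω, X 1 ω ∂P) := by
  refine tendstoInMeasure_real_of_forall fun ε hε η hη => ?_
  set m := ∫ ω, X 1 ω ∂P with hm
  have hη2 : η / 2 ≠ 0 := by simp [hη, ENNReal.div_eq_zero_iff]
  obtain ⟨K, hK, hKP⟩ := hX.exists_measure_barrier_gt_le hf hlim hη2
  -- The bound `m / 4` forces a crossing before `T`; the other keeps `δ T` below `ε m u / 4 + δ`.
  set δ := min (m / 4) (ε * m ^ 2 / 8) with hδd
  have hδ : 0 < δ := by positivity
  have hδ1 : δ ≤ m / 4 := min_le_left _ _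
  have hδ2 : δ ≤ ε * m ^ 2 / 8 := min_le_right _ _
  have hev := (hX.centered m).eventually_measure_exists_abs_gt_le
    (hint.sub (integrable_const _)) (integral_centered hint) hδ hη2
  have hT : Tendsto (fun u : ℝ => ⌈2 * u / m⌉₊) atTop atTop :=
    tendsto_nat_ceil_atTop.comp
      ((tendsto_id.const_mul_atTop two_pos).atTop_div_const hmean)
  have hbig : ∀ᶠ u : ℝ in atTop, δ + K < ε * m / 2 * u :=
    (tendsto_id.const_mul_atTop (by positivity)).eventually_gt_atTop _
  filter_upwards [hT.eventually hev, hbig, eventually_gt_atTop 0] with u hu hub hu0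
  refine le_trans ?_ (((measure_union_le _ _).trans (add_le_add hKP hu)).trans_eq
    (ENNReal.add_halves η))
  refine measure_mono_ae ?_
  filter_upwards [hX.ae_tau_lt_top hint hmean hf u, hX.cadlag] with ω hfin hcad hω
  by_contra hcon
  obtain ⟨hc1, hc2⟩ := not_or.1 hcon
  have hc1' : ∀ t, f t - X t ω ≤ K := fun t => not_lt.1 fun h => hc1 ⟨t, h⟩
  set T : ℕ := ⌈2 * u / m⌉₊ with hTd
  have hc2' : ∀ t ≤ (T : ℝ≥0), |X t ω - m * t| ≤ δ * T :=
    fun t ht => not_lt.1 fun h => hc2 ⟨t, ht, h⟩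
  have hTge : 2 * u / m ≤ T := Nat.le_ceil _
  have hTle : (T : ℝ) ≤ 2 * u / m + 1 := (Nat.ceil_lt_add_one (by positivity)).le
  have hTpos : 0 < (T : ℝ) := lt_of_lt_of_le (by positivity) hTge
  have hτT : (tau f X u ω).toReal < T := by
    by_contra! hle
    have hT2 : 2 * u ≤ m * T := by rw [div_le_iff₀ hmean] at hTge; linarith
    have hlt : (u + δ * T) / m < T := by
      rw [div_lt_iff₀ hmean]
      nlinarith
    obtain ⟨z, hz1, hz2⟩ := exists_between hlt
    lift z to ℝ≥0 using le_trans (by positivity) hz1.le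
    rw [div_lt_iff₀ hmean] at hz1
    have h1 := (abs_le.1 (hc2' z (by exact_mod_cast hz2.le))).1
    refine (le_of_lt_toReal_passageTime hfin (hz2.trans_le hle)).not_gt
      ((lt_reflect_iff hf hcad).2 (Or.inl ?_))
    linarith
  have key := abs_toReal_passageTime_sub_le hf hcad (c := 0) (e := δ * T) (A := -1) (B := T)
    hmean hK.le hc1' (fun t _ ht => by simpa using hc2' t (by exact_mod_cast ht)) hfin
    (Or.inr (by positivity)) (lt_of_lt_of_le (by norm_num) ENNReal.toReal_nonneg) hτT
  change |m * (tau f X u ω).toReal + 0 - u| ≤ δ * T + K at key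
  change ε ≤ |(tau f X u ω).toReal / u - 1 / m| at hω
  have heq : (tau f X u ω).toReal / u - 1 / m = (m * (tau f X u ω).toReal + 0 - u) / (m * u) := by
    field_simp
    ring
  rw [heq, abs_div, abs_of_pos (mul_pos hmean hu0), le_div_iff₀ (mul_pos hmean hu0)] at hω
  have h3 : δ * T ≤ δ * (2 * u / m) + δ := by nlinarith
  have h4 : δ * (2 * u / m) ≤ ε * m ^ 2 / 8 * (2 * u / m) := by gcongr
  have h5 : ε * m ^ 2 / 8 * (2 * u / m) = ε * m * u / 4 := by field_simp; ring
  have h6 : 0 < ε * m * u := by positivity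
  linarith

/-! ### Central limit theorem when the process escapes above the barrier -/

/-- The central limit theorem for a Lévy process at integer times. -/
lemma tendstoInDistribution_natCast (hX : IsLevyProcess X P) (hL2 : MemLp (X 1) 2 P) :
    TendstoInDistribution (fun (n : ℕ) ω => (√n)⁻¹ * (X n ω - n * ∫ ω, X 1 ω ∂P)) atTop
      (id : ℝ → ℝ) (fun _ => P) (gaussianReal 0 Var[X 1; P].toNNReal) := by
  let ξ : ℕ → Ω → ℝ := fun i ω => X ((i + 1 : ℕ) : ℝ≥0) ω - X (i : ℝ≥0) ω
  have hid : ∀ i, IdentDistrib (ξ i) (X 1) P P := fun i => by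
    simpa [ξ] using hX.stationary i 1
  have hind : iIndepFun ξ P := hX.indep.nat (t := fun n : ℕ => (n : ℝ≥0)) Nat.mono_cast
  have := tendstoInDistribution_inv_sqrt_mul_sum_sub (P' := gaussianReal 0 Var[X 1; P].toNNReal)
    (Y := id) (X := ξ) (by rw [(hid 0).variance_eq]; exact HasLaw.id) ((hid 0).memLp_iff.2 hL2)
    hind fun i => (hid i).trans (hid 0).symm
  refine this.congr (fun n => ?_) EventuallyEq.rfl
  filter_upwards [hX.zero] with ω h0
  rw [(hid 0).integral_eq, Finset.sum_range_sub (fun i : ℕ => X (i : ℝ≥0) ω)]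
  simp [h0]

end IsLevyProcess

lemma tendstoInMeasure_const_of_tendsto {Ω ι : Type*} [MeasurableSpace Ω] {P : Measure Ω}
    {l : Filter ι} {a : ι → ℝ} {c : ℝ} (h : Tendsto a l (𝓝 c)) :
    TendstoInMeasure P (fun i (_ : Ω) => a i) l (fun _ => c) := by
  refine tendstoInMeasure_real_of_forall fun ε hε η _ => ?_
  filter_upwards [Metric.tendsto_nhds.1 h ε hε] with i hi
  rw [Real.dist_eq] at hi
  simp [not_le.2 hi]

lemma barrierInv_le {f : ℝ≥0 → ℝ} {u : ℝ} {t : ℝ≥0} (h : u ≤ f t) : barrierInv f u ≤ t :=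
  iInf₂_le t h

namespace IsLevyProcess

variable {Ω : Type*} [MeasurableSpace Ω] {P : Measure Ω} [IsProbabilityMeasure P]
  {X : ℝ≥0 → Ω → ℝ} {f : ℝ≥0 → ℝ}

/-- The central limit theorem for a Lévy process at the deterministic approximation `⌊u / m⌋` of
the first passage time. -/
lemma tendstoInDistribution_floor (hX : IsLevyProcess X P) (hL2 : MemLp (X 1) 2 P)
    (hmean : 0 < ∫ ω, X 1 ω ∂P) :
    TendstoInDistribution
      (fun (u : ℝ) ω => -(X ⌊u / ∫ ω, X 1 ω ∂P⌋₊ ω -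
        (∫ ω, X 1 ω ∂P) * ⌊u / ∫ ω, X 1 ω ∂P⌋₊) / ((∫ ω, X 1 ω ∂P) * √u)) atTop
      (id : ℝ → ℝ) (fun _ => P)
      (gaussianReal 0 (Var[X 1; P] / (∫ ω, X 1 ω ∂P) ^ 3).toNNReal) := by
  set m := ∫ ω, X 1 ω ∂P with hm
  have hsm : 0 < √m := Real.sqrt_pos.2 hmean
  have hsm2 : √m ^ 2 = m := Real.sq_sqrt hmean.le
  -- Scaling by `c` produces the limiting variance directly; the factor `√(m n / u) → 1` then
  -- replaces `√n` by `√u` through Slutsky.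
  set c : ℝ := -1 / (m * √m) with hc
  have hY : IsLevyProcess (fun t ω => c * X t ω) P := by simpa using hX.affine c 0
  have hvar : Var[fun ω => c * X 1 ω; P] = Var[X 1; P] / m ^ 3 := by
    rw [variance_const_mul, hc, div_pow, mul_pow, hsm2]
    field_simp
  have hclt := hY.tendstoInDistribution_natCast (hL2.const_mul c)
  rw [hvar] at hclt
  have hn : Tendsto (fun u : ℝ => ⌊u / m⌋₊) atTop atTop :=
    tendsto_nat_floor_atTop.comp (tendsto_id.atTop_div_const hmean)
  have hclt' : TendstoInDistribution (fun (u : ℝ) ω => (√⌊u / m⌋₊)⁻¹ *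
      (c * X ⌊u / m⌋₊ ω - ⌊u / m⌋₊ * ∫ ω, c * X 1 ω ∂P)) atTop
      (id : ℝ → ℝ) (fun _ => P) (gaussianReal 0 (Var[X 1; P] / m ^ 3).toNNReal) :=
    ⟨fun u => hclt.forall_aemeasurable _, hclt.aemeasurable_limit, hclt.tendsto.comp hn⟩
  have hratio : Tendsto (fun u : ℝ => √(m * (⌊u / m⌋₊ / u))) atTop (𝓝 1) := by
    have h1 : Tendsto (fun u : ℝ => (⌊m⁻¹ * u⌋₊ : ℝ) / u) atTop (𝓝 m⁻¹) :=
      tendsto_nat_floor_mul_div_atTop (inv_nonneg.2 hmean.le)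
    have h2 := (h1.const_mul m).sqrt
    rw [mul_inv_cancel₀ hmean.ne', Real.sqrt_one] at h2
    refine h2.congr fun u => ?_
    rw [div_eq_inv_mul u m]
  have hmul := hclt'.continuous_comp_prodMk_of_tendstoInMeasure_const
    (g := fun p : ℝ × ℝ => p.1 * p.2) (by fun_prop)
    (tendstoInMeasure_const_of_tendsto (P := P) hratio) (fun _ => aemeasurable_const)
  have hmeas : ∀ u : ℝ, AEMeasurable
      (fun ω => -(X ⌊u / m⌋₊ ω - m * ⌊u / m⌋₊) / (m * √u)) P := fun u =>
    (((hX.measurable _).sub_const _).neg.div_const _).aemeasurable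
  refine tendstoInDistribution_of_tendstoInMeasure_sub _ _
    (hmul.congr (fun _ => EventuallyEq.rfl) (T := id)
      (Eventually.of_forall fun x => mul_one x)) ?_ hmeas
  refine tendstoInMeasure_real_of_forall fun ε hε η _ => ?_
  filter_upwards [hn.eventually_gt_atTop 0, eventually_gt_atTop 0] with u hn0 hu0
  refine (measure_mono_null (fun ω hω => ?_) (measure_empty (μ := P))).trans_le zero_le
  change ε ≤ |-(X ⌊u / m⌋₊ ω - m * ⌊u / m⌋₊) / (m * √u) - (√⌊u / m⌋₊)⁻¹ *
    (c * X ⌊u / m⌋₊ ω - ⌊u / m⌋₊ * ∫ ω, c * X 1 ω ∂P) * √(m * (⌊u / m⌋₊ / u)) - 0| at hω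
  have hnpos : 0 < √(⌊u / m⌋₊ : ℝ) := Real.sqrt_pos.2 (by exact_mod_cast hn0)
  have hupos : 0 < √u := Real.sqrt_pos.2 hu0
  rw [integral_const_mul, ← hm, Real.sqrt_mul hmean.le, Real.sqrt_div (Nat.cast_nonneg _)] at hω
  have : -(X ⌊u / m⌋₊ ω - m * ⌊u / m⌋₊) / (m * √u) - (√⌊u / m⌋₊)⁻¹ *
      (c * X ⌊u / m⌋₊ ω - ⌊u / m⌋₊ * (c * m)) * (√m * (√⌊u / m⌋₊ / √u)) - 0 = 0 := by
    rw [hc]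
    field_simp
    ring
  rw [this, abs_zero] at hω
  exact absurd hω (not_le.2 hε)

/-- Central limit theorem for the first passage times when the process escapes above the
barrier. -/
lemma tendstoInDistribution_tau (hX : IsLevyProcess X P) (hL2 : MemLp (X 1) 2 P)
    (hmean : 0 < ∫ ω, X 1 ω ∂P) (hf : IsCadlag f)
    (hlim : ∀ᵐ ω ∂P, Tendsto (fun t => X t ω - f t) atTop atTop) :
    TendstoInDistribution
      (fun (u : ℝ) ω => ((tau f X u ω).toReal - u / ∫ ω, X 1 ω ∂P) / √u) atTop
      (id : ℝ → ℝ) (fun _ => P)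
      (gaussianReal 0 (Var[X 1; P] / (∫ ω, X 1 ω ∂P) ^ 3).toNNReal) := by
  have hint : Integrable (X 1) P := hL2.integrable one_le_two
  refine tendstoInDistribution_of_tendstoInMeasure_sub _ _
    (hX.tendstoInDistribution_floor hL2 hmean) ?_
    fun u => ((aemeasurable_tau hf hX u).ennreal_toReal.sub_const _).div_const _
  have hlln := hX.tendstoInMeasure_tau_div hint hmean hf hlim
  have hcent := integral_centered hint
  set m := ∫ ω, X 1 ω ∂P with hm
  refine tendstoInMeasure_real_of_forall fun ε hε η hη => ?_
  have hη3 : η / 3 ≠ 0 := by simp [hη, ENNReal.div_eq_zero_iff]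
  obtain ⟨K, hK, hKP⟩ := hX.exists_measure_barrier_gt_le hf hlim hη3
  have hδ : 0 < ε * m / 4 := by positivity
  obtain ⟨ε₁, hε₁, hmod⟩ := (hX.centered m).exists_eventually_measure_exists_abs_sub_gt_le
    (hL2.sub (memLp_const _)) hcent hδ hη3
  -- The first bound keeps `τ` inside the window of the modulus estimate, the second keeps `τ`
  -- positive.
  set ε₂ := min (ε₁ / 4) (1 / (2 * m)) with hε₂d
  have hε₂ : 0 < ε₂ := by positivity
  have hbig : ∀ᶠ u : ℝ in atTop, K < ε * m / 2 * √u :=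
    (Real.tendsto_sqrt_atTop.const_mul_atTop (by positivity)).eventually_gt_atTop _
  have hbig' : ∀ᶠ u : ℝ in atTop, 2 ≤ ε₁ / 4 * u :=
    (tendsto_id.const_mul_atTop (by positivity)).eventually_ge_atTop _
  filter_upwards [hmod, hlln.eventually_measure_le hε₂ hη3, hbig, hbig', eventually_gt_atTop 0]
    with u hmodu hllnu hKu hwu hu0
  set n : ℕ := ⌊u / m⌋₊ with hn
  set w : ℕ := ⌊ε₁ * u / 2⌋₊ with hw
  have hn1 : (n : ℝ) ≤ u / m := Nat.floor_le (by positivity)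
  have hn2 : u / m < n + 1 := Nat.lt_floor_add_one _
  have hw1 : (w : ℝ) ≤ ε₁ * u / 2 := Nat.floor_le (by positivity)
  have hw2 : ε₁ * u / 2 < w + 1 := Nat.lt_floor_add_one _
  -- The window has length `2 w` from `n - w`; truncated subtraction starts it at `0` when `w > n`.
  have hmodw := hmodu ((n - w : ℕ) : ℝ≥0) ((2 * w : ℕ) : ℝ≥0) (by push_cast; linarith)
  refine le_trans ?_ (((measure_union_le _ _).trans
    (add_le_add ((measure_union_le _ _).trans (add_le_add hKP hllnu)) hmodw)).trans_eq
      (ENNReal.add_thirds η))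
  refine measure_mono_ae ?_
  filter_upwards [hX.ae_tau_lt_top hint hmean hf u, hX.cadlag] with ω hfin hcad hω
  by_contra hcon
  obtain ⟨hcon', hc3⟩ := not_or.1 hcon
  obtain ⟨hc1, hc2⟩ := not_or.1 hcon'
  have hc1' : ∀ t, f t - X t ω ≤ K := fun t => not_lt.1 fun h => hc1 ⟨t, h⟩
  have hc2' : |(tau f X u ω).toReal / u - 1 / m| < ε₂ := not_le.1 hc2
  have hc3' : ∀ r ≤ ((2 * w : ℕ) : ℝ≥0), |(X ((n - w : ℕ) + r) ω - m * ((n - w : ℕ) + r : ℝ≥0)) -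
      (X (n - w : ℕ) ω - m * ((n - w : ℕ) : ℝ≥0))| ≤ ε * m / 4 * √u :=
    fun t ht => not_lt.1 fun h => hc3 ⟨t, ht, h⟩
  have hsu : 0 < √u := Real.sqrt_pos.2 hu0
  have hτ : |(tau f X u ω).toReal - u / m| < ε₂ * u := by
    have : (tau f X u ω).toReal - u / m = ((tau f X u ω).toReal / u - 1 / m) * u := by
      field_simp
    rw [this, abs_mul, abs_of_pos hu0]
    gcongr
  obtain ⟨hτ1, hτ2⟩ := abs_lt.1 hτ
  have hε₂a : ε₂ * u ≤ ε₁ / 4 * u := by gcongr; exact min_le_left _ _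
  have hε₂b : ε₂ * u ≤ 1 / (2 * m) * u := by gcongr; exact min_le_right _ _
  have hwin : ∀ t : ℝ≥0, u / m - ε₁ / 4 * u ≤ t → t ≤ u / m + ε₁ / 4 * u →
      |(X t ω - m * t) - (X (n - w : ℕ) ω - m * ((n - w : ℕ) : ℝ≥0))| ≤ ε * m / 4 * √u := by
    intro t ht1 ht2
    have h1 : ((n - w : ℕ) : ℝ≥0) ≤ t := by
      rcases le_total n w with h | h
      · simp [Nat.sub_eq_zero_of_le h]
      · rw [← NNReal.coe_le_coe, NNReal.coe_natCast, Nat.cast_sub h]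
        linarith
    obtain ⟨r, rfl⟩ := exists_add_of_le h1
    refine hc3' r ?_
    rw [← NNReal.coe_le_coe]
    have h2 : (n : ℝ) ≤ (n - w : ℕ) + w := by
      exact_mod_cast (by omega : n ≤ n - w + w)
    rw [NNReal.coe_add, NNReal.coe_natCast] at ht2
    rw [NNReal.coe_natCast, Nat.cast_mul, Nat.cast_ofNat]
    linarith
  have hnwin := hwin n (by rw [NNReal.coe_natCast]; linarith)
    (by rw [NNReal.coe_natCast]; linarith)
  -- Oscillation is measured from the left end of the window; recentering at `n` doubles the error.
  have key := abs_toReal_passageTime_sub_le hf hcad (c := X n ω - m * (n : ℝ≥0))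
    (e := ε * m / 2 * √u) hmean hK.le hc1'
    (fun t ht1 ht2 => by
      have h1 := abs_le.1 (hwin t ht1 ht2)
      have h2 := abs_le.1 hnwin
      exact abs_le.2 ⟨by linarith, by linarith⟩) hfin (Or.inl ?_) ?_ ?_
  · change |m * (tau f X u ω).toReal + (X n ω - m * (n : ℝ≥0)) - u| ≤ ε * m / 2 * √u + K at key
    rw [NNReal.coe_natCast] at key
    change ε ≤ |((tau f X u ω).toReal - u / m) / √u - -(X n ω - m * n) / (m * √u) - 0| at hω
    have heq : ((tau f X u ω).toReal - u / m) / √u - -(X n ω - m * n) / (m * √u) - 0 =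
        (m * (tau f X u ω).toReal + (X n ω - m * n) - u) / (m * √u) := by
      field_simp
      ring
    rw [heq, abs_div, abs_of_pos (mul_pos hmean hsu), le_div_iff₀ (mul_pos hmean hsu)] at hω
    linarith
  · change 0 < (tau f X u ω).toReal
    have : 1 / (2 * m) * u = u / m / 2 := by field_simp
    have : 0 < u / m := by positivity
    linarith
  · change _ < (tau f X u ω).toReal
    linarith
  · change (tau f X u ω).toReal < _
    linarith

/-! ### The process escapes below the barrier -/

/-- If the process escapes below the barrier, the barrier grows at least as fast as the mean
drift. -/
lemma barrierInv_limit_bound (hX : IsLevyProcess X P) (hint : Integrable (X 1) P)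
    (hmean : 0 < ∫ ω, X 1 ω ∂P)
    (hlim : ∀ᵐ ω ∂P, Tendsto (fun t => X t ω - f t) atTop atBot) {l : ℝ≥0∞}
    (hl : Tendsto (fun u : ℝ => barrierInv f u / ENNReal.ofReal u) atTop (𝓝 l)) :
    l ≠ ∞ ∧ l.toReal * ∫ ω, X 1 ω ∂P ≤ 1 := by
  set m := ∫ ω, X 1 ω ∂P with hm
  have key : ∀ c, 0 < c → c < m → l ≤ ENNReal.ofReal (1 / c) := by
    intro c hc hcm
    -- The barrier is deterministic, so a single good path bounds it.
    obtain ⟨ω, h1, h2⟩ := ((hX.ae_tendsto_div hint).and hlim).exists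
    have h2' : Tendsto (fun n : ℕ => X n ω - f n) atTop atBot :=
      h2.comp tendsto_natCast_atTop_atTop
    have h3 : ∀ᶠ n : ℕ in atTop, c * n ≤ f n := by
      filter_upwards [h1.eventually_const_lt hcm, h2'.eventually_le_atBot 0,
        eventually_gt_atTop 0] with n hn1 hn2 hn3
      have hn3' : (0 : ℝ) < n := by exact_mod_cast hn3
      rw [lt_div_iff₀ hn3'] at hn1
      linarith
    have hceil : Tendsto (fun u : ℝ => ⌈u / c⌉₊) atTop atTop :=
      tendsto_nat_ceil_atTop.comp (tendsto_id.atTop_div_const hc)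
    have hup : Tendsto (fun u : ℝ => ENNReal.ofReal (1 / c + u⁻¹)) atTop
        (𝓝 (ENNReal.ofReal (1 / c))) := by
      have := (tendsto_inv_atTop_zero (𝕜 := ℝ)).const_add (1 / c)
      rw [add_zero] at this
      exact ENNReal.tendsto_ofReal this
    refine le_of_tendsto_of_tendsto hl hup ?_
    filter_upwards [hceil.eventually h3, eventually_gt_atTop 0] with u hu hu0
    have hge : u / c ≤ ⌈u / c⌉₊ := Nat.le_ceil _
    have hle : (⌈u / c⌉₊ : ℝ) ≤ u / c + 1 := (Nat.ceil_lt_add_one (by positivity)).le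
    have hfu : u ≤ f ⌈u / c⌉₊ := by
      rw [div_le_iff₀ hc] at hge
      linarith
    have hb : barrierInv f u ≤ ENNReal.ofReal (u / c + 1) := by
      refine (barrierInv_le hfu).trans ?_
      rw [← ENNReal.ofReal_coe_nnreal]
      exact ENNReal.ofReal_le_ofReal (by simpa using hle)
    refine (ENNReal.div_le_div_right hb _).trans_eq ?_
    rw [← ENNReal.ofReal_div_of_pos hu0]
    congr 1
    field_simp
  have hfin : l ≠ ∞ :=
    ((key (m / 2) (by positivity) (by linarith)).trans_lt ENNReal.ofReal_lt_top).ne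
  refine ⟨hfin, ?_⟩
  by_contra! hlt
  have hl0 : 0 < l.toReal := by
    by_contra! h
    nlinarith
  have hlt' : 1 / l.toReal < m := by rw [div_lt_iff₀ hl0]; linarith
  obtain ⟨c, hc1, hc2⟩ := exists_between hlt'
  have hc0 : 0 < c := lt_trans (by positivity) hc1
  have := ENNReal.toReal_le_of_le_ofReal (by positivity) (key c hc0 hc2)
  rw [le_div_iff₀ hc0] at this
  rw [div_lt_iff₀ hl0] at hc1
  linarith

/-- Weak law of large numbers for the first passage times when the process escapes below the
barrier. -/
lemma tendstoInMeasure_tau_div_of_atBot (hX : IsLevyProcess X P) (hint : Integrable (X 1) P)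
    (hmean : 0 < ∫ ω, X 1 ω ∂P) (hf : IsCadlag f) {l : ℝ≥0∞}
    (hl : Tendsto (fun u : ℝ => barrierInv f u / ENNReal.ofReal u) atTop (𝓝 l))
    (hfin : l ≠ ∞) (hlm : l.toReal * ∫ ω, X 1 ω ∂P ≤ 1) :
    TendstoInMeasure P (fun (u : ℝ) ω => (tau f X u ω).toReal / u) atTop
      (fun _ => l.toReal) := by
  set m := ∫ ω, X 1 ω ∂P with hm
  set L := l.toReal with hL
  set b : ℝ → ℝ := fun u => (barrierInv f u).toReal with hb
  have hbfin : ∀ᶠ u : ℝ in atTop, barrierInv f u ≠ ∞ := by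
    filter_upwards [hl.eventually_lt_const hfin.lt_top] with u hu h
    rw [h, ENNReal.top_div_of_ne_top ENNReal.ofReal_ne_top] at hu
    exact lt_irrefl _ hu
  have hbl : Tendsto (fun u => b u / u) atTop (𝓝 L) := by
    refine ((ENNReal.tendsto_toReal hfin).comp hl).congr' ?_
    filter_upwards [eventually_ge_atTop 0] with u hu
    rw [Function.comp, ENNReal.toReal_div, ENNReal.toReal_ofReal hu]
  have hbl1 : Tendsto (fun u => b (u + 1) / u) atTop (𝓝 L) := by
    have h1 : Tendsto (fun u : ℝ => u + 1) atTop atTop :=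
      tendsto_atTop_add_const_right _ _ tendsto_id
    have h2 : Tendsto (fun u : ℝ => 1 + u⁻¹) atTop (𝓝 1) := by
      simpa using (tendsto_inv_atTop_zero (𝕜 := ℝ)).const_add 1
    have h3 := (hbl.comp h1).mul h2
    rw [mul_one] at h3
    refine h3.congr' ?_
    filter_upwards [eventually_gt_atTop 0] with u hu
    simp only [Function.comp]
    field_simp
  have hbfin1 : ∀ᶠ u : ℝ in atTop, barrierInv f (u + 1) ≠ ∞ :=
    (tendsto_atTop_add_const_right _ _ tendsto_id).eventually hbfin
  refine tendstoInMeasure_real_of_forall fun ε hε η hη => ?_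
  have hupper : ∀ᶠ u : ℝ in atTop, ∀ᵐ ω ∂P, (tau f X u ω).toReal / u < L + ε := by
    filter_upwards [hbl1.eventually_lt_const (lt_add_of_pos_right L hε), hbfin1,
      eventually_gt_atTop 0] with u hu hufin hu0
    filter_upwards [hX.cadlag] with ω hcad
    refine lt_of_le_of_lt ?_ hu
    -- The choice `s = t` gives `V t ≥ f t`; the extra `1` turns `≥` into the strict crossing.
    have hle : tau f X u ω ≤ barrierInv f (u + 1) := le_iInf₂ fun t ht =>
      passageTime_le ((lt_reflect_iff hf hcad).2 (Or.inr ⟨t, le_rfl, by linarith⟩))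
    have := ENNReal.toReal_mono hufin hle
    gcongr
  -- For `L < ε` the lower bound is just `τ ≥ 0`; otherwise `ρ` below is positive.
  rcases lt_or_ge L ε with hLε | hLε
  · filter_upwards [hupper, eventually_gt_atTop 0] with u hu hu0
    refine le_trans (measure_mono_ae (t := ∅) ?_) (by simp)
    filter_upwards [hu] with ω h1 h2
    change ε ≤ |(tau f X u ω).toReal / u - L| at h2
    have h3 : 0 ≤ (tau f X u ω).toReal / u := by positivity
    exact absurd h2 (not_le.2 (abs_lt.2 ⟨by linarith, by linarith⟩))
  set ρ := L - ε / 2 with hρ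
  have hρ0 : 0 < ρ := by linarith
  have hmρ : m ≤ 1 / ρ := by
    rw [le_div_iff₀ hρ0]
    nlinarith
  obtain ⟨v₀, hv₀⟩ := eventually_atTop.1
    ((hbl.eventually_const_lt (by linarith : ρ < L)).and (hbfin.and (eventually_gt_atTop 0)))
  -- If `f s` exceeded `v`, then `f⁻¹(v) ≤ s ≤ ρ v`, against `f⁻¹(v) > ρ v`.
  have hfs : ∀ s : ℝ≥0, f s ≤ max v₀ 0 + s / ρ := by
    intro s
    set v := max v₀ (s / ρ) with hv
    obtain ⟨h1, h2, h3⟩ := hv₀ v (le_max_left _ _)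
    have hvle : v ≤ max v₀ 0 + s / ρ := by
      have : 0 ≤ (s : ℝ) / ρ := by positivity
      exact max_le (by linarith [le_max_left v₀ 0]) (by linarith [le_max_right v₀ 0])
    refine le_trans ?_ hvle
    by_contra! hlt
    have h4 : b v ≤ s := ENNReal.toReal_le_coe_of_le_coe (barrierInv_le hlt.le)
    have h5 : s / ρ ≤ v := le_max_right _ _
    rw [lt_div_iff₀ h3] at h1
    rw [div_le_iff₀ hρ0] at h5
    linarith
  set δ := ε / (16 * ρ ^ 2) with hδd
  have hδ : 0 < δ := by positivity
  have hev := (hX.centered m).eventually_measure_exists_abs_gt_le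
    (hint.sub (integrable_const _)) (integral_centered hint) hδ hη
  have hT : Tendsto (fun u : ℝ => ⌈ρ * u⌉₊) atTop atTop :=
    tendsto_nat_ceil_atTop.comp (tendsto_id.const_mul_atTop hρ0)
  have hbig : ∀ᶠ u : ℝ in atTop, 2 * δ + max v₀ 0 < ε / (8 * ρ) * u :=
    (tendsto_id.const_mul_atTop (by positivity)).eventually_gt_atTop _
  filter_upwards [hupper, hT.eventually hev, hbig, eventually_gt_atTop 0] with u hup hu hub hu0
  refine le_trans (measure_mono_ae ?_) hu
  filter_upwards [hup, hX.cadlag, hX.ae_tau_lt_top hint hmean hf u] with ω h1 hcad hτfin h2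
  change ε ≤ |(tau f X u ω).toReal / u - L| at h2
  by_contra hcon
  set T : ℕ := ⌈ρ * u⌉₊ with hTd
  have hcon' : ∀ t ≤ (T : ℝ≥0), |X t ω - m * t| ≤ δ * T :=
    fun t ht => not_lt.1 fun h => hcon ⟨t, ht, h⟩
  have hT1 : ρ * u ≤ T := Nat.le_ceil _
  have hT2 : (T : ℝ) ≤ ρ * u + 1 := (Nat.ceil_lt_add_one (by positivity)).le
  have hτ : (tau f X u ω).toReal < (L - ε / 2 - ε / 4) * u := by
    rw [← div_lt_iff₀ hu0]
    by_contra! h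
    exact absurd h2 (not_le.2 (abs_lt.2 ⟨by linarith, by linarith⟩))
  obtain ⟨t, -, ht, hut⟩ := exists_of_toReal_passageTime_lt hτfin hτ
  have htT : (t : ℝ) ≤ T := by nlinarith
  -- Since `m ≤ 1/ρ`, `m (t - s) + s/ρ ≤ t/ρ`; the two `δ T` are the errors at `s` and `t`.
  have hbound : u < t / ρ + 2 * (δ * T) + max v₀ 0 := by
    have h3 := abs_le.1 (hcon' t (by exact_mod_cast htT))
    have ht0 : (0 : ℝ) ≤ t := t.2
    have h4 : m * t ≤ 1 / ρ * t := by gcongr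
    have h5 : 0 ≤ max v₀ 0 := le_max_right _ _
    have h6 : t / ρ = 1 / ρ * t := by ring
    have h7 : 0 ≤ δ * T := by positivity
    rcases (lt_reflect_iff hf hcad).1 hut with h | ⟨s, hst, h⟩
    · linarith
    · have hst' : (s : ℝ) ≤ t := by exact_mod_cast hst
      have h8 := abs_le.1 (hcon' s (by exact_mod_cast hst'.trans htT))
      have h9 : m * (t - s) ≤ 1 / ρ * (t - s) := by gcongr
      have h10 := hfs s
      have h11 : s / ρ = 1 / ρ * s := by ring
      nlinarith
  have h3 : t / ρ ≤ u - 2 * (ε / (8 * ρ) * u) := by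
    rw [div_le_iff₀ hρ0]
    have : (u - 2 * (ε / (8 * ρ) * u)) * ρ = (ρ - ε / 4) * u := by field_simp; ring
    rw [this, hρ]
    exact ht.le
  have h4 : 2 * (δ * T) ≤ 2 * (δ * (ρ * u + 1)) := by gcongr
  have h5 : 2 * (δ * (ρ * u + 1)) = ε / (8 * ρ) * u + 2 * δ := by
    rw [hδd]
    field_simp
    ring
  linarith

end IsLevyProcess

theorem mainTheorem2 {Ω : Type*} [MeasurableSpace Ω] (P : Measure Ω) [IsProbabilityMeasure P]
    (X : ℝ≥0 → Ω → ℝ) (hX : IsLevyProcess X P)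
    (hint : Integrable (X 1) P) (hmean : 0 < ∫ ω, X 1 ω ∂P)
    (f : ℝ≥0 → ℝ) (hf : IsCadlag f) :
    (∀ u : ℝ, ∀ᵐ ω ∂P, tau f X u ω < ∞) ∧
    ((∀ᵐ ω ∂P, Tendsto (fun t => X t ω - f t) atTop atTop) →
      TendstoInMeasure P (fun (u : ℝ) ω => (tau f X u ω).toReal / u) atTop
        (fun _ => 1 / ∫ ω, X 1 ω ∂P) ∧
      (MemLp (X 1) 2 P →
        TendstoInDistribution
          (fun (u : ℝ) ω => ((tau f X u ω).toReal - u / ∫ ω, X 1 ω ∂P) / √u) atTop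
          (id : ℝ → ℝ) (fun _ => P)
          (gaussianReal 0 (Var[X 1; P] / (∫ ω, X 1 ω ∂P) ^ 3).toNNReal))) ∧
    ((∀ᵐ ω ∂P, Tendsto (fun t => X t ω - f t) atTop atBot) →
      ∀ l : ℝ≥0∞, Tendsto (fun u : ℝ => barrierInv f u / ENNReal.ofReal u) atTop (𝓝 l) →
        l ≠ ∞ ∧
        TendstoInMeasure P (fun (u : ℝ) ω => (tau f X u ω).toReal / u) atTop
          (fun _ => l.toReal)) := by
  refine ⟨hX.ae_tau_lt_top hint hmean hf, fun hlim =>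
    ⟨hX.tendstoInMeasure_tau_div hint hmean hf hlim, fun hL2 =>
      hX.tendstoInDistribution_tau hL2 hmean hf hlim⟩, fun hlim l hl => ?_⟩
  obtain ⟨hfin, hlm⟩ := hX.barrierInv_limit_bound hint hmean hlim hl
  exact ⟨hfin, hX.tendstoInMeasure_tau_div_of_atBot hint hmean hf hl hfin hlm⟩
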